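/- **Particle states.** Each particle has a 21-dimensional state space with standard basis $E_x, e_x, U_x, u_x, W, w, R_x, \hat R_x, L, \uparrow, \hat\uparrow, \downarrow_x, \langle, \rangle$, where $x\in\{0,1\}$ is a qubit value. The transition rules $ab\to cd$ on two neighbouring particles are, for all $x,y\in\{0,1\}$: $R_xU_y\to u_yR_x$; $R_xW\to wR_x$; $R_xE_y\to\downarrow_xE_y$; $w\downarrow_x\to LE_x$; $wL\to LW$; $u_yL\to LU_y$; $e_yL\to e_y\uparrow$; $\uparrow U_x\to e_xR_x$; $\hat\uparrow U_x\to e_x\hat R_x$; $\hat R_xU_y\to u_y\hat R_x$; $\hat R_xW\to w\hat R_x$; $\hat R_x\rangle\to\downarrow_x\rangle$. **Ground state of a segment.** Let $n=2m+3\ge 3$ be odd. For $x\in\{0,1\}^m$ let $P_x$ be the set of standard basis states of a chain of $n$ particles that can be reached from $\langle\,\hat\uparrow\,U_{x_1}\cdots U_{x_m}\,W^m\,\rangle$ by applying transition rules in the forward direction, let $|\phi_x\rangle=|P_x|^{-1/2}\sum_{s\in P_x}|s\rangle$, and let $|\phi_g\rangle=2^{-m/2}\sum_{x\in\{0,1\}^m}|\phi_x\rangle$.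 **States on the cycle.** Let $t\ge2$ and consider a cycle of $nt$ particles. For $0\le i\le n-1$ cut the cycle into $t$ segments of $n$ consecutive particles, the first one starting at site $i$, and let $|\psi_i\rangle$ be the tensor product of $t$ copies of $|\phi_g\rangle$, one on each segment. **Good particles.** Let $A$ be a set of particles on the cycle. A particle in $A$ is *good* for $|\psi_i\rangle$ if it is the $p$-th particle ($1\le p\le n$) of some segment, where $2\le p\le n/4$ or $3n/4\le p\le n-1$, and the $(n+1-p)$-th particle of the same segment (its entangled partner) is not in $A$. **Lemma.** Let $A$ be a contiguous set of $r\le nt-n$ particles on the cycle, let $0\le i\le n-1$, and let $\rho_i^A$ be the reduced state of $|\psi_i\rangle\langle\psi_i|$ on $A$. Then the von Neumann entropy $S(\rho_i^A)=-\operatorname{tr}(\rho_i^A\log_2\rho_i^A)$ satisfies $$S(\rho_i^A)\ \ge\ \tfrac14\,\bigl|\{\text{particles in }A\text{ that are good for }|\psi_i\rangle\}\bigr| .$$ -/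

import Mathlib

/-- The 21 standard basis states of one particle.  A `Bool` argument is the value of the qubit
stored in a two-state subsystem. -/
inductive SiteState : Type
  /-- upper case `E`: entangled qubit, to the right of the control site -/
  | upE (x : Bool)
  /-- lower case `e`: entangled qubit, to the left of the control site -/
  | loE (x : Bool)
  /-- upper case `U`: unentangled qubit, to the right of the control site -/
  | upU (x : Bool)
  /-- lower case `u`: unentangled qubit, to the left of the control site -/
  | loU (x : Bool)
  /-- upper case `W`: waiting particle, to the right of the control site -/
  | upW
  /-- lower case `w`: waiting particle, to the left of the control site -/
  | loW
  /-- single right-moving control state -/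
  | right (x : Bool)
  /-- double right-moving control state -/
  | dright (x : Bool)
  /-- left-moving control state -/
  | left
  /-- single left-end turning control state -/
  | turnUp
  /-- double left-end turning control state -/
  | dturnUp
  /-- right-end turning control state -/
  | turnDown (x : Bool)
  /-- left delimiter -/
  | leftEnd
  /-- right delimiter -/
  | rightEnd
  deriving DecidableEq, Fintype

/-- `TransitionRule a b c d` is the rule `a b → c d` on two neighbouring particles. -/
inductive TransitionRule : SiteState → SiteState → SiteState → SiteState → Prop
  | right_U (x y : Bool) : TransitionRule (.right x) (.upU y) (.loU y) (.right x)
  | right_W (x : Bool) : TransitionRule (.right x) .upW .loW (.right x)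
  | right_E (x y : Bool) : TransitionRule (.right x) (.upE y) (.turnDown x) (.upE y)
  | w_turnDown (x : Bool) : TransitionRule .loW (.turnDown x) .left (.upE x)
  | w_left : TransitionRule .loW .left .left .upW
  | u_left (y : Bool) : TransitionRule (.loU y) .left .left (.upU y)
  | e_left (y : Bool) : TransitionRule (.loE y) .left (.loE y) .turnUp
  | turnUp_U (x : Bool) : TransitionRule .turnUp (.upU x) (.loE x) (.right x)
  | dturnUp_U (x : Bool) : TransitionRule .dturnUp (.upU x) (.loE x) (.dright x)
  | dright_U (x y : Bool) : TransitionRule (.dright x) (.upU y) (.loU y) (.dright x)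
  | dright_W (x : Bool) : TransitionRule (.dright x) .upW .loW (.dright x)
  | dright_end (x : Bool) : TransitionRule (.dright x) .rightEnd (.turnDown x) .rightEnd

/-- Directed edges of the state graph of the finite chain with `n` particles: `s'` arises from the
standard basis state `s` by one application of a transition rule to two neighbouring particles. -/
def ChainStep (n : ℕ) (s s' : Fin n → SiteState) : Prop :=
  ∃ k l : Fin n, (l : ℕ) = (k : ℕ) + 1 ∧ TransitionRule (s k) (s l) (s' k) (s' l) ∧
    ∀ q : Fin n, q ≠ k → q ≠ l → s' q = s q

/-- For `n = 2 m + 3`: the start state consisting of the left delimiter, the double left-end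
turning control state, `m` sites `U` carrying the qubit values `x`, `m` sites `W`, and the right
delimiter. -/
def startState (n : ℕ) (x : Fin ((n - 3) / 2) → Bool) : Fin n → SiteState := fun k =>
  if (k : ℕ) = 0 then .leftEnd
  else if (k : ℕ) = 1 then .dturnUp
  else if h : (k : ℕ) - 2 < (n - 3) / 2 then .upU (x ⟨(k : ℕ) - 2, h⟩)
  else if (k : ℕ) < 2 + 2 * ((n - 3) / 2) then .upW
  else .rightEnd

/-- The standard basis states on the path of the state graph that begins with the start state. -/
def startPath (n : ℕ) (x : Fin ((n - 3) / 2) → Bool) : Set (Fin n → SiteState) :=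
  {s | Relation.ReflTransGen (ChainStep n) (startState n x) s}

open Classical in
/-- `|φ_x⟩`, the uniform superposition of the states on the path that begins with the start state,
given by its amplitudes in the standard basis. -/
noncomputable def phiPath (n : ℕ) (x : Fin ((n - 3) / 2) → Bool) (s : Fin n → SiteState) : ℂ :=
  if s ∈ startPath n x then (((Real.sqrt ((startPath n x).ncard : ℝ))⁻¹ : ℝ) : ℂ) else 0

/-- `|φ_g⟩ = 2^{-m/2} ∑_x |φ_x⟩`, the ground state of the finite chain. -/
noncomputable def phiGround (n : ℕ) (s : Fin n → SiteState) : ℂ :=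
  (((Real.sqrt (2 ^ ((n - 3) / 2) : ℝ))⁻¹ : ℝ) : ℂ) *
    ∑ x : Fin ((n - 3) / 2) → Bool, phiPath n x s

/-- On the cycle with `n t` particles cut into `t` segments of length `n`, the first of which starts
at site `i`: the site of the `p`-th particle (`1 ≤ p ≤ n`) of the `j`-th segment (`0 ≤ j < t`). -/
def segmentSite (n t : ℕ) [NeZero (n * t)] (i : Fin n) (j p : ℕ) : Fin (n * t) :=
  Fin.ofNat (n * t) ((i : ℕ) + j * n + (p - 1))

/-- `|ψ_i⟩`, the tensor product of `t` copies of `|φ_g⟩` placed on the `t` segments of length `n` of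
the cycle, rotated by `i` positions. -/
noncomputable def psiCycle (n t : ℕ) [NeZero (n * t)] (i : Fin n)
    (s : Fin (n * t) → SiteState) : ℂ :=
  ∏ j : Fin t, phiGround n (fun q : Fin n => s (segmentSite n t i j ((q : ℕ) + 1)))

/-- The contiguous set of the particles `a, a + 1, …, a + r - 1` on the cycle with `N` sites. -/
def arc {N : ℕ} [NeZero N] (a : Fin N) (r : ℕ) : Finset (Fin N) :=
  (Finset.range r).image (fun k => Fin.ofNat N ((a : ℕ) + k))

open Classical in
/-- The particles in `A` that are good for `|ψ_i⟩`: those that are the `p`-th particle of a segment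
with `2 ≤ p ≤ n/4` or `3n/4 ≤ p ≤ n - 1` and whose partner, the `(n + 1 - p)`-th particle of the
same segment, is not in `A`. -/
noncomputable def goodParticles (n t : ℕ) [NeZero (n * t)] (i : Fin n)
    (A : Finset (Fin (n * t))) : Finset (Fin (n * t)) :=
  A.filter (fun k => ∃ j p : ℕ, j < t ∧ k = segmentSite n t i j p ∧
    ((2 ≤ p ∧ (p : ℝ) ≤ (n : ℝ) / 4) ∨ (3 * (n : ℝ) / 4 ≤ (p : ℝ) ∧ p + 1 ≤ n)) ∧
    segmentSite n t i j (n + 1 - p) ∉ A)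

/-- The basis state that agrees with `a` on the particles in `A` and with `b` on the others. -/
def glue {S Q : Type*} [DecidableEq S] (A : Finset S) (a : {k // k ∈ A} → Q)
    (b : {k // k ∉ A} → Q) : S → Q :=
  fun k => if h : k ∈ A then a ⟨k, h⟩ else b ⟨k, h⟩

/-- The reduced density matrix on `A` of the pure state with amplitudes `ψ`: the partial trace of
`|ψ⟩⟨ψ|` over the particles outside `A`, in the standard basis. -/
noncomputable def reducedDensity {S Q : Type*} [Fintype S] [DecidableEq S] [Fintype Q]
    (ψ : (S → Q) → ℂ) (A : Finset S) :
    Matrix ({k // k ∈ A} → Q) ({k // k ∈ A} → Q) ℂ :=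
  Matrix.of fun a a' => ∑ b : {k // k ∉ A} → Q, ψ (glue A a b) * star (ψ (glue A a' b))

theorem reducedDensity_isHermitian {S Q : Type*} [Fintype S] [DecidableEq S] [Fintype Q]
    (ψ : (S → Q) → ℂ) (A : Finset S) : (reducedDensity ψ A).IsHermitian := by
  ext a a'
  simp [reducedDensity, Matrix.conjTranspose_apply, mul_comm]

/-- The von Neumann entropy `- tr (ρ log₂ ρ)`, in bits, through the eigenvalues of `ρ`. -/
noncomputable def vonNeumannEntropy {ι : Type*} [Fintype ι] [DecidableEq ι]
    (ρ : Matrix ι ι ℂ) (hρ : ρ.IsHermitian) : ℝ :=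
  ∑ k : ι, - (hρ.eigenvalues k * Real.logb 2 (hρ.eigenvalues k))

/-- The entropy of the state with amplitudes `ψ` traced down to the particles in `A`. -/
noncomputable def entanglementEntropy {S Q : Type*} [Fintype S] [DecidableEq S] [Fintype Q]
    [DecidableEq Q] (ψ : (S → Q) → ℂ) (A : Finset S) : ℝ :=
  vonNeumannEntropy (reducedDensity ψ A) (reducedDensity_isHermitian ψ A)

/-!
The segments are in a product state, so the entropy of `A` is the sum of the entropies of its parts
in the segments, and a single segment is enough.

There the transition rules trace out a path without branching for every string of qubits, and
`|φ_g⟩` is the uniform superposition over all times and all strings. Qubit `q` becomes entangled in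
round `q`; from then on its value can be read off at both of its sites, of which, for a good
particle, one lies in `A` and one outside. Let `K` be the last good qubit. Since `2 K < m`, it is
entangled for at least a quarter of all times. That it is entangled is visible at its right site;
because `A` and its complement have the same entropy, this site may be assumed to lie outside `A`.

Conditioned on `K` being entangled, which happens with probability `p ≥ 1/4` and which is observed
outside `A`, the values of all `g` good qubits are uniform and known on both sides. The reduced
state therefore has a part of trace `p` with all eigenvalues at most `p 2^{-g}`, and the concavity
of `-x log x` gives entropy at least `p g ≥ g / 4`.
-/

open Matrix Finset

section Entropy

variable {ι κ : Type*} [Fintype ι] [DecidableEq ι] [Fintype κ] [DecidableEq κ]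

theorem vonNeumannEntropy_eq_sum_negMulLog {ρ : Matrix ι ι ℂ} (hρ : ρ.IsHermitian) :
    vonNeumannEntropy ρ hρ = (∑ k, Real.negMulLog (hρ.eigenvalues k)) / Real.log 2 := by
  simp only [vonNeumannEntropy, sum_div, Real.negMulLog, Real.logb, neg_mul, neg_div, mul_div_assoc]

theorem vonNeumannEntropy_eq_sum_roots_charpoly {ρ : Matrix ι ι ℂ} (hρ : ρ.IsHermitian) :
    vonNeumannEntropy ρ hρ =
      (ρ.charpoly.roots.map fun z => Real.negMulLog z.re).sum / Real.log 2 := by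
  rw [vonNeumannEntropy_eq_sum_negMulLog, hρ.roots_charpoly_eq_eigenvalues, Multiset.map_map]
  rfl

theorem vonNeumannEntropy_eq_of_charpoly_eq {ρ : Matrix ι ι ℂ} {σ : Matrix κ κ ℂ}
    (hρ : ρ.IsHermitian) (hσ : σ.IsHermitian) (h : ρ.charpoly = σ.charpoly) :
    vonNeumannEntropy ρ hρ = vonNeumannEntropy σ hσ := by
  simp only [vonNeumannEntropy_eq_sum_roots_charpoly, h]

theorem vonNeumannEntropy_mul_conjTranspose_comm (M : Matrix ι κ ℂ) :
    vonNeumannEntropy (M * Mᴴ) (isHermitian_mul_conjTranspose_self M) =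
      vonNeumannEntropy (Mᴴ * M) (isHermitian_conjTranspose_mul_self M) := by
  have hroots := congrArg Polynomial.roots (charpoly_mul_comm' M Mᴴ)
  simp only [Polynomial.roots_mul, ((Polynomial.monic_X_pow _).mul (charpoly_monic _)).ne_zero,
    ne_eq, not_false_eq_true, Polynomial.roots_X_pow] at hroots
  have hsum := congrArg (fun s => (s.map fun z : ℂ => Real.negMulLog z.re).sum) hroots
  simp only [Multiset.map_add, Multiset.sum_add, Multiset.map_nsmul, Multiset.sum_nsmul,
    Multiset.map_singleton, Multiset.sum_singleton, Complex.zero_re, Real.negMulLog_zero,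
    smul_zero, zero_add] at hsum
  simp only [vonNeumannEntropy_eq_sum_roots_charpoly, hsum]

theorem vonNeumannEntropy_eq_of_charpoly_eq_prod {ρ : Matrix ι ι ℂ} (hρ : ρ.IsHermitian)
    {d : ι → ℝ} (h : ρ.charpoly = ∏ k, (Polynomial.X - Polynomial.C (d k : ℂ))) :
    vonNeumannEntropy ρ hρ = (∑ k, Real.negMulLog (d k)) / Real.log 2 := by
  have hroots : ρ.charpoly.roots = univ.val.map fun k => (d k : ℂ) := by
    rw [h, ← Polynomial.roots_multiset_prod_X_sub_C (univ.val.map fun k => (d k : ℂ)),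
      Multiset.map_map]
    rfl
  rw [vonNeumannEntropy_eq_sum_roots_charpoly, hroots, Multiset.map_map]
  rfl

end Entropy

section PiKronecker

variable {J : Type*} [Fintype J] {ι κ μ : J → Type*} {R : Type*} [CommRing R]

/-- The Kronecker product of a finite family of matrices, indexed by dependent functions: the matrix
of a tensor product of operators in the product basis. -/
def piKronecker (M : ∀ j, Matrix (ι j) (κ j) R) : Matrix (∀ j, ι j) (∀ j, κ j) R :=
  of fun a b => ∏ j, M j (a j) (b j)

theorem piKronecker_mul [DecidableEq J] [∀ j, Fintype (κ j)] (M : ∀ j, Matrix (ι j) (κ j) R)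
    (N : ∀ j, Matrix (κ j) (μ j) R) :
    piKronecker (fun j => M j * N j) = piKronecker M * piKronecker N := by
  ext a c
  simp only [piKronecker, of_apply, mul_apply, prod_univ_sum, Fintype.piFinset_univ,
    prod_mul_distrib]

theorem piKronecker_diagonal [∀ j, DecidableEq (ι j)] [DecidableEq (∀ j, ι j)]
    (d : ∀ j, ι j → R) :
    piKronecker (fun j => diagonal (d j)) = diagonal fun a => ∏ j, d j (a j) := by
  ext a b
  by_cases hab : a = b
  · simp only [piKronecker, of_apply, hab, diagonal_apply_eq]
  · obtain ⟨j, hj⟩ := Function.ne_iff.1 hab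
    rw [diagonal_apply_ne _ hab]
    exact prod_eq_zero (mem_univ j) (diagonal_apply_ne _ hj)

theorem piKronecker_one [∀ j, DecidableEq (ι j)] [DecidableEq (∀ j, ι j)] :
    piKronecker (fun j => (1 : Matrix (ι j) (ι j) R)) = 1 := by
  simp only [← diagonal_one, piKronecker_diagonal, prod_const_one]

theorem charpoly_piKronecker_conj [DecidableEq J] [∀ j, Fintype (ι j)] [∀ j, DecidableEq (ι j)]
    (U V : ∀ j, Matrix (ι j) (ι j) R) (hVU : ∀ j, V j * U j = 1) (d : ∀ j, ι j → R) :
    (piKronecker fun j => U j * diagonal (d j) * V j).charpoly =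
      ∏ a : ∀ j, ι j, (Polynomial.X - Polynomial.C (∏ j, d j (a j))) := by
  rw [piKronecker_mul, piKronecker_mul, mul_assoc, charpoly_mul_comm, mul_assoc, ← piKronecker_mul]
  simp only [hVU, piKronecker_one, mul_one, piKronecker_diagonal, charpoly_diagonal]

theorem conjTranspose_piKronecker [StarRing R] (M : ∀ j, Matrix (ι j) (κ j) R) :
    (piKronecker M)ᴴ = piKronecker fun j => (M j)ᴴ := by
  ext a b
  simp only [piKronecker, conjTranspose_apply, of_apply, star_prod]

theorem isHermitian_piKronecker [StarRing R] {ρ : ∀ j, Matrix (ι j) (ι j) R}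
    (hρ : ∀ j, (ρ j).IsHermitian) : (piKronecker ρ).IsHermitian := by
  rw [IsHermitian, conjTranspose_piKronecker, funext fun j => (hρ j).eq]

theorem negMulLog_prod {α : Type*} [DecidableEq α] (s : Finset α) (x : α → ℝ) :
    Real.negMulLog (∏ j ∈ s, x j) = ∑ j ∈ s, Real.negMulLog (x j) * ∏ k ∈ s.erase j, x k := by
  induction s using Finset.induction_on with
  | empty => simp only [prod_empty, sum_empty, Real.negMulLog_one]
  | insert i s hi ih =>
    rw [prod_insert hi, sum_insert hi, erase_insert hi, Real.negMulLog_mul, ih, mul_sum, mul_comm]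
    congr 1
    refine sum_congr rfl fun j hj => ?_
    rw [erase_insert_of_ne (ne_of_mem_of_not_mem hj hi).symm,
      prod_insert fun h => hi (mem_of_mem_erase h)]
    ring

theorem sum_negMulLog_prod [DecidableEq J] [∀ j, Fintype (ι j)] (d : ∀ j, ι j → ℝ)
    (hd : ∀ j, ∑ a, d j a = 1) :
    ∑ a : ∀ j, ι j, Real.negMulLog (∏ j, d j (a j)) = ∑ j, ∑ a, Real.negMulLog (d j a) := by
  simp only [negMulLog_prod]
  rw [sum_comm]
  refine sum_congr rfl fun j _ => ?_
  set g : ∀ k, ι k → ℝ := fun k y => if k = j then Real.negMulLog (d k y) else d k y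
  have hgj : ∀ y, g j y = Real.negMulLog (d j y) := fun y => if_pos rfl
  have hgne : ∀ k ∈ univ.erase j, ∀ y, g k y = d k y := fun k hk y => if_neg (ne_of_mem_erase hk)
  calc ∑ a : ∀ j, ι j, Real.negMulLog (d j (a j)) * ∏ k ∈ univ.erase j, d k (a k)
      = ∑ a : ∀ j, ι j, ∏ k, g k (a k) := by
        refine sum_congr rfl fun a _ => ?_
        rw [← mul_prod_erase univ _ (mem_univ j), hgj, prod_congr rfl fun k hk => hgne k hk _]
    _ = ∏ k, ∑ y, g k y := by rw [prod_univ_sum, Fintype.piFinset_univ]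
    _ = ∑ y, Real.negMulLog (d j y) := by
        rw [← mul_prod_erase univ _ (mem_univ j), prod_eq_one, mul_one,
          sum_congr rfl fun y _ => hgj y]
        exact fun k hk => (sum_congr rfl fun y _ => hgne k hk y).trans (hd k)

theorem vonNeumannEntropy_piKronecker [DecidableEq J] [∀ j, Fintype (ι j)]
    [∀ j, DecidableEq (ι j)] {ρ : ∀ j, Matrix (ι j) (ι j) ℂ} (hρ : ∀ j, (ρ j).IsHermitian)
    (htr : ∀ j, (ρ j).trace = 1) :
    vonNeumannEntropy (piKronecker ρ) (isHermitian_piKronecker hρ) =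
      ∑ j, vonNeumannEntropy (ρ j) (hρ j) := by
  have hd : ∀ j, ∑ a, (hρ j).eigenvalues a = 1 := fun j => by
    exact Complex.ofReal_injective <| by
      simpa using ((hρ j).trace_eq_sum_eigenvalues).symm.trans (htr j)
  have hdiag : ∀ j, ρ j = (hρ j).eigenvectorUnitary.1 *
      diagonal (fun a => ((hρ j).eigenvalues a : ℂ)) * star (hρ j).eigenvectorUnitary.1 :=
    fun j => (hρ j).spectral_theorem
  have hcharpoly : (piKronecker ρ).charpoly = ∏ a : ∀ j, ι j,
      (Polynomial.X - Polynomial.C ((∏ j, (hρ j).eigenvalues (a j) : ℝ) : ℂ)) := by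
    conv_lhs => rw [funext hdiag]
    rw [charpoly_piKronecker_conj _ _ fun j => Unitary.coe_star_mul_self _]
    simp only [Complex.ofReal_prod]
  rw [vonNeumannEntropy_eq_of_charpoly_eq_prod _ hcharpoly, sum_negMulLog_prod _ hd, sum_div]
  simp only [vonNeumannEntropy_eq_sum_negMulLog]

end PiKronecker

section LowerBound

theorem mul_le_negMulLog {u c : ℝ} (hu : 0 ≤ u) (h : u ≤ Real.exp (-c)) :
    u * c ≤ Real.negMulLog u := by
  rcases hu.eq_or_lt with rfl | hu
  · simp
  have hlog : Real.log u ≤ -c := (Real.log_le_iff_le_exp hu).2 h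
  rw [Real.negMulLog, neg_mul, ← mul_neg]
  gcongr
  linarith

theorem mul_le_negMulLog_add {p s t c : ℝ} (hs : 0 ≤ s) (ht : 0 ≤ t) (htp : t ≤ 1 - p)
    (hsp : s ≤ p * Real.exp (-c)) : s * c ≤ Real.negMulLog (s + t) := by
  have hp : 0 ≤ p := nonneg_of_mul_nonneg_left (hs.trans hsp) (Real.exp_pos _)
  rcases hp.eq_or_lt with rfl | hp
  · obtain rfl : s = 0 := by linarith
    simpa using Real.negMulLog_nonneg ht (by linarith)
  have hsdiv : s / p * c ≤ Real.negMulLog (s / p) :=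
    mul_le_negMulLog (by positivity) ((div_le_iff₀' hp).2 hsp)
  rcases (ht.trans htp).eq_or_lt with hp1 | hp1
  · obtain rfl : t = 0 := by linarith
    obtain rfl : p = 1 := by linarith
    simpa using hsdiv
  calc s * c = p * (s / p * c) := by field_simp
    _ ≤ p * Real.negMulLog (s / p) + (1 - p) * Real.negMulLog (t / (1 - p)) := by
        have ht' := Real.negMulLog_nonneg (div_nonneg ht hp1.le) ((div_le_one hp1).2 htp)
        nlinarith [mul_le_mul_of_nonneg_left hsdiv hp.le, mul_nonneg hp1.le ht']
    _ ≤ Real.negMulLog (p * (s / p) + (1 - p) * (t / (1 - p))) :=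
        Real.concaveOn_negMulLog.2 (div_nonneg hs hp.le) (div_nonneg ht hp1.le) hp.le hp1.le
          (add_sub_cancel p 1)
    _ = Real.negMulLog (s + t) := by rw [mul_div_cancel₀ _ hp.ne', mul_div_cancel₀ _ hp1.ne']

variable {ι β : Type*} [Fintype ι] [Fintype β]

open scoped ComplexOrder

theorem star_dotProduct_self (x : ι → ℂ) : star x ⬝ᵥ x = ((∑ k, ‖x k‖ ^ 2 : ℝ) : ℂ) := by
  simp [dotProduct, Complex.conj_mul']

-- `V` is block diagonal with respect to the keys `f` and `g`, and the operator norm of a block is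
-- at most its Frobenius norm.
theorem sum_norm_sq_conjTranspose_mulVec_le {Z : Type*} [DecidableEq Z] (V : Matrix ι β ℂ)
    {f : ι → Z} {g : β → Z} (hfg : ∀ a b, V a b ≠ 0 → f a = g b) {c : ℝ}
    (hc : ∀ z, ∑ b with g b = z, ∑ a, ‖V a b‖ ^ 2 ≤ c) (x : ι → ℂ) :
    ∑ b, ‖(Vᴴ *ᵥ x) b‖ ^ 2 ≤ c * ∑ a, ‖x a‖ ^ 2 := by
  have hcol : ∀ b, ‖(Vᴴ *ᵥ x) b‖ ^ 2 ≤
      ∑ a with f a = g b, ‖x a‖ ^ 2 * ∑ a', ‖V a' b‖ ^ 2 := fun b => by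
    have hrestrict : (Vᴴ *ᵥ x) b = ∑ a with f a = g b, star (V a b) * x a := by
      refine (sum_filter_of_ne fun a _ h => hfg a b fun h0 => h ?_).symm
      simp only [conjTranspose_apply, h0, star_zero, zero_mul]
    calc ‖(Vᴴ *ᵥ x) b‖ ^ 2 ≤ (∑ a with f a = g b, ‖x a‖ * ‖V a b‖) ^ 2 := by
          rw [hrestrict]
          gcongr
          refine (norm_sum_le _ _).trans_eq (sum_congr rfl fun a _ => ?_)
          rw [norm_mul, norm_star, mul_comm]
      _ ≤ (∑ a with f a = g b, ‖x a‖ ^ 2) * ∑ a with f a = g b, ‖V a b‖ ^ 2 :=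
          sum_mul_sq_le_sq_mul_sq _ _ _
      _ ≤ _ := by
          rw [← sum_mul]
          gcongr
          exact filter_subset _ _
  calc ∑ b, ‖(Vᴴ *ᵥ x) b‖ ^ 2
      ≤ ∑ b, ∑ a with f a = g b, ‖x a‖ ^ 2 * ∑ a', ‖V a' b‖ ^ 2 := sum_le_sum fun b _ => hcol b
    _ = ∑ a, ‖x a‖ ^ 2 * ∑ b with g b = f a, ∑ a', ‖V a' b‖ ^ 2 := by
        simp only [sum_filter, mul_sum, mul_ite, mul_zero, eq_comm]
        exact sum_comm
    _ ≤ ∑ a, ‖x a‖ ^ 2 * c := by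
        gcongr with a
        exact hc (f a)
    _ = c * ∑ a, ‖x a‖ ^ 2 := by rw [← sum_mul, mul_comm]

theorem trace_mul_conjTranspose_self (M : Matrix ι β ℂ) :
    (M * Mᴴ).trace = ((∑ a, ∑ b, ‖M a b‖ ^ 2 : ℝ) : ℂ) := by
  simp [trace, mul_apply, Complex.mul_conj']

variable [DecidableEq ι]

theorem posSemidef_smul_one_sub_mul_conjTranspose {Z : Type*} [DecidableEq Z] (V : Matrix ι β ℂ)
    {f : ι → Z} {g : β → Z} (hfg : ∀ a b, V a b ≠ 0 → f a = g b) {c : ℝ}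
    (hc : ∀ z, ∑ b with g b = z, ∑ a, ‖V a b‖ ^ 2 ≤ c) :
    ((c : ℂ) • (1 : Matrix ι ι ℂ) - V * Vᴴ).PosSemidef := by
  refine .of_dotProduct_mulVec_nonneg
    ((isHermitian_one.smul (Complex.conj_ofReal c)).sub (isHermitian_mul_conjTranspose_self V))
    fun x => ?_
  have hV : star x ⬝ᵥ ((V * Vᴴ) *ᵥ x) = ((∑ b, ‖(Vᴴ *ᵥ x) b‖ ^ 2 : ℝ) : ℂ) := by
    rw [← mulVec_mulVec, dotProduct_mulVec, ← star_dotProduct_self, star_mulVec,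
      conjTranspose_conjTranspose]
  rw [sub_mulVec, smul_mulVec, one_mulVec, dotProduct_sub, dotProduct_smul, hV,
    star_dotProduct_self, smul_eq_mul, ← Complex.ofReal_mul, ← Complex.ofReal_sub,
    Complex.zero_le_real, sub_nonneg]
  exact sum_norm_sq_conjTranspose_mulVec_le V hfg hc x

theorem mul_le_vonNeumannEntropy_add {σ τ : Matrix ι ι ℂ} {p q : ℝ} (hσ : σ.PosSemidef)
    (hτ : τ.PosSemidef) (hσp : σ.trace = p) (hτp : τ.trace = (1 - p : ℝ))
    (hle : (((p * 2 ^ (-q) : ℝ) : ℂ) • (1 : Matrix ι ι ℂ) - σ).PosSemidef) :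
    p * q ≤ vonNeumannEntropy (σ + τ) (hσ.1.add hτ.1) := by
  -- In an eigenbasis of `σ + τ` only the diagonals of `σ` and `τ` matter.
  set U := (hσ.1.add hτ.1).eigenvectorUnitary.1
  have hUU : Uᴴ * U = 1 := Unitary.coe_star_mul_self _
  have hUU' : U * Uᴴ = 1 := Unitary.coe_mul_star_self _
  set s : ι → ℝ := fun k => ((Uᴴ * σ * U) k k).re
  set t : ι → ℝ := fun k => ((Uᴴ * τ * U) k k).re
  have hs : ∀ k, 0 ≤ s k := fun k => (hσ.conjTranspose_mul_mul_same U).diag_nonneg.1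
  have ht : ∀ k, 0 ≤ t k := fun k => (hτ.conjTranspose_mul_mul_same U).diag_nonneg.1
  have htrace : ∀ ρ : Matrix ι ι ℂ, ∑ k, ((Uᴴ * ρ * U) k k).re = ρ.trace.re := fun ρ => by
    rw [← Complex.re_sum]
    change (Uᴴ * ρ * U).trace.re = _
    rw [trace_mul_cycle, hUU', one_mul]
  have htle : ∀ k, t k ≤ 1 - p := fun k =>
    (single_le_sum (fun k _ => ht k) (mem_univ k)).trans_eq ((htrace τ).trans (by simp [hτp]))
  have hsle : ∀ k, s k ≤ p * 2 ^ (-q) := fun k => by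
    have h := (hle.conjTranspose_mul_mul_same U).diag_nonneg (i := k)
    rw [mul_sub, sub_mul, mul_smul_comm, smul_mul_assoc, mul_one, hUU] at h
    simpa [s] using h.1
  have heig : ∀ k, (hσ.1.add hτ.1).eigenvalues k = s k + t k := fun k => by
    have h := congrFun₂ (hσ.1.add hτ.1).conjStarAlgAut_star_eigenvectorUnitary k k
    rw [Unitary.conjStarAlgAut_star_apply, mul_add, add_mul] at h
    simpa [s, t, U, star_eq_conjTranspose] using (congrArg Complex.re h).symm
  rw [vonNeumannEntropy_eq_sum_negMulLog, le_div_iff₀ (Real.log_pos one_lt_two)]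
  calc p * q * Real.log 2 = ∑ k, s k * (q * Real.log 2) := by
        rw [← sum_mul, htrace, hσp, Complex.ofReal_re, mul_assoc]
    _ ≤ _ := sum_le_sum fun k _ => by
        rw [heig]
        refine mul_le_negMulLog_add (hs k) (ht k) (htle k) ((hsle k).trans_eq ?_)
        rw [Real.rpow_def_of_pos two_pos, mul_neg, mul_comm (Real.log 2)]

theorem mul_le_vonNeumannEntropy_mul_conjTranspose {Z : Type*} [DecidableEq Z] {M : Matrix ι β ℂ}
    (hM : ∑ a, ∑ b, ‖M a b‖ ^ 2 = 1) {e : β → Prop} [DecidablePred e] {f : ι → Z} {g : β → Z}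
    (hfg : ∀ a b, e b → M a b ≠ 0 → f a = g b) {p q : ℝ}
    (hp : ∑ b with e b, ∑ a, ‖M a b‖ ^ 2 = p)
    (hq : ∀ z, ∑ b with e b ∧ g b = z, ∑ a, ‖M a b‖ ^ 2 ≤ p * 2 ^ (-q)) :
    p * q ≤ vonNeumannEntropy (M * Mᴴ) (isHermitian_mul_conjTranspose_self M) := by
  set V : Matrix ι β ℂ := of fun a b => if e b then M a b else 0
  set W : Matrix ι β ℂ := of fun a b => if e b then 0 else M a b
  have hV : ∀ b, ∑ a, ‖V a b‖ ^ 2 = if e b then ∑ a, ‖M a b‖ ^ 2 else 0 := fun b => by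
    split_ifs with hb <;> simp [V, hb]
  have hW : ∀ b, ∑ a, ‖W a b‖ ^ 2 = if e b then 0 else ∑ a, ‖M a b‖ ^ 2 := fun b => by
    split_ifs with hb <;> simp [W, hb]
  have hVW : M * Mᴴ = V * Vᴴ + W * Wᴴ := by
    ext a a'
    simp only [mul_apply, Matrix.add_apply, conjTranspose_apply, ← sum_add_distrib]
    refine sum_congr rfl fun b _ => ?_
    by_cases hb : e b <;> simp [V, W, hb]
  have hVp : (V * Vᴴ).trace = p := by
    rw [trace_mul_conjTranspose_self, sum_comm]
    simp only [hV, ← sum_filter, hp]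
  have hWp : (W * Wᴴ).trace = (1 - p : ℝ) := by
    rw [trace_mul_conjTranspose_self, sum_comm, ← hM, sum_comm (f := fun a b => ‖M a b‖ ^ 2), ← hp]
    simp only [hW, sum_filter, ← sum_sub_distrib]
    congr! 2 with b
    split_ifs <;> simp
  have hVfg : ∀ a b, V a b ≠ 0 → f a = g b := fun a b hab => by
    by_cases hb : e b
    · exact hfg a b hb (by simpa [V, hb] using hab)
    · exact absurd (if_neg hb) hab
  simp only [hVW]
  refine mul_le_vonNeumannEntropy_add (posSemidef_self_mul_conjTranspose V)
    (posSemidef_self_mul_conjTranspose W) hVp hWp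
    (posSemidef_smul_one_sub_mul_conjTranspose V hVfg fun z => ?_)
  simpa only [hV, ← sum_filter, filter_filter, and_comm] using hq z

end LowerBound

section EntanglementEntropy

variable {S Q : Type*} [DecidableEq S]

/-- The amplitudes of a state, arranged as a matrix whose rows are the basis states of the particles
in `A` and whose columns are those of the other particles. -/
def amplitudeMatrix (ψ : (S → Q) → ℂ) (A : Finset S) :
    Matrix ({k // k ∈ A} → Q) ({k // k ∉ A} → Q) ℂ :=
  of fun a b => ψ (glue A a b)

theorem domRestrict_glue (A : Finset S) (a : {k // k ∈ A} → Q) (b : {k // k ∉ A} → Q) :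
    (A : Set S).domRestrict (glue A a b) = a :=
  funext fun k => dif_pos k.2

theorem domRestrict_compl_glue (A : Finset S) (a : {k // k ∈ A} → Q) (b : {k // k ∉ A} → Q) :
    (A : Set S)ᶜ.domRestrict (glue A a b) = b :=
  funext fun k => dif_neg k.2

variable [Fintype S] [Fintype Q]

theorem sum_sum_glue {M : Type*} [AddCommMonoid M] (A : Finset S) (G : (S → Q) → M) :
    ∑ a, ∑ b, G (glue A a b) = ∑ s, G s := by
  rw [← Fintype.sum_prod_type']
  exact (Equiv.piEquivPiSubtypeProd (· ∈ A) fun _ => Q).symm.sum_comp G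

theorem reducedDensity_eq_mul_conjTranspose (ψ : (S → Q) → ℂ) (A : Finset S) :
    reducedDensity ψ A = amplitudeMatrix ψ A * (amplitudeMatrix ψ A)ᴴ :=
  rfl

theorem trace_reducedDensity (ψ : (S → Q) → ℂ) (A : Finset S) :
    (reducedDensity ψ A).trace = ((∑ s, ‖ψ s‖ ^ 2 : ℝ) : ℂ) := by
  rw [reducedDensity_eq_mul_conjTranspose, trace_mul_conjTranspose_self,
    ← sum_sum_glue A fun s => ‖ψ s‖ ^ 2]
  rfl

variable [DecidableEq Q]

theorem entanglementEntropy_compl (ψ : (S → Q) → ℂ) (A : Finset S) :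
    entanglementEntropy ψ Aᶜ = entanglementEntropy ψ A := by
  set M := amplitudeMatrix ψ A
  let e : ({k // k ∈ Aᶜ} → Q) ≃ ({k // k ∉ A} → Q) :=
    (Equiv.subtypeEquivRight fun _ => mem_compl).arrowCongr (Equiv.refl Q)
  let e' : ({k // k ∉ Aᶜ} → Q) ≃ ({k // k ∈ A} → Q) :=
    (Equiv.subtypeEquivRight fun _ => by simp).arrowCongr (Equiv.refl Q)
  have hM : amplitudeMatrix ψ Aᶜ = Mᵀ.submatrix e e' := by
    ext b a
    refine congrArg ψ (funext fun k => ?_)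
    by_cases hk : k ∈ A <;>
      simp only [glue, mem_compl, hk, dite_not, dite_true, dite_false, e, e'] <;> rfl
  have hcharpoly : (reducedDensity ψ Aᶜ).charpoly = (Mᴴ * M).charpoly := by
    rw [reducedDensity_eq_mul_conjTranspose, hM, conjTranspose_submatrix, submatrix_mul_equiv,
      ← charpoly_transpose (Mᴴ * M), transpose_mul, ← charpoly_reindex e.symm (Mᵀ * _)]
    rfl
  calc entanglementEntropy ψ Aᶜ
      = vonNeumannEntropy (Mᴴ * M) (isHermitian_conjTranspose_mul_self M) :=
        vonNeumannEntropy_eq_of_charpoly_eq _ _ hcharpoly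
    _ = entanglementEntropy ψ A := (vonNeumannEntropy_mul_conjTranspose_comm M).symm

theorem mul_le_entanglementEntropy_of_dependsOn {Z : Type*} [Nonempty Z] [DecidableEq Z]
    {ψ : (S → Q) → ℂ} {A : Finset S} (hψ : ∑ s, ‖ψ s‖ ^ 2 = 1) {E : (S → Q) → Prop}
    [DecidablePred E] {keyIn keyOut : (S → Q) → Z} (hE : DependsOn E (A : Set S)ᶜ)
    (hin : DependsOn keyIn A) (hout : DependsOn keyOut (A : Set S)ᶜ)
    (hkey : ∀ s, ψ s ≠ 0 → E s → keyIn s = keyOut s) {p q : ℝ}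
    (hp : ∑ s with E s, ‖ψ s‖ ^ 2 = p)
    (hq : ∀ z, ∑ s with E s ∧ keyOut s = z, ‖ψ s‖ ^ 2 ≤ p * 2 ^ (-q)) :
    p * q ≤ entanglementEntropy ψ A := by
  classical
  obtain ⟨e, rfl⟩ := dependsOn_iff_exists_comp.1 hE
  obtain ⟨f, rfl⟩ := dependsOn_iff_exists_comp.1 hin
  obtain ⟨g, rfl⟩ := dependsOn_iff_exists_comp.1 hout
  have hsum : ∀ (P : ({k // k ∉ A} → Q) → Prop) [DecidablePred P],
      ∑ b with P b, ∑ a, ‖amplitudeMatrix ψ A a b‖ ^ 2 =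
        ∑ s with P ((A : Set S)ᶜ.domRestrict s), ‖ψ s‖ ^ 2 := fun P _ => by
    simp only [sum_filter]
    rw [← sum_sum_glue A, sum_comm]
    simp only [domRestrict_compl_glue, amplitudeMatrix, of_apply, sum_ite_irrel, sum_const_zero]
  refine mul_le_vonNeumannEntropy_mul_conjTranspose (e := e) (f := f) (g := g) ?_ ?_ ?_ ?_
  · rw [← hψ, ← sum_sum_glue A]
    rfl
  · intro a b hb hab
    simpa only [Function.comp_apply, domRestrict_glue, domRestrict_compl_glue] using
      hkey (glue A a b) hab (by simpa only [Function.comp_apply, domRestrict_compl_glue] using hb)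
  · exact (hsum e).trans (hp ▸ by congr)
  · exact fun z => (hsum fun b => e b ∧ g b = z).trans_le (by convert hq z <;> rfl)

end EntanglementEntropy

section ProductState

variable {J P S Q : Type*}

/-- Configurations of the sites satisfying `r`, read off block by block along `e : J × P ≃ S`.
A separate predicate `r'` for the blocks lets the type on the right be the one that occurs in a
reduced density matrix. -/
def blockEquiv (e : J × P ≃ S) {r : S → Prop} {r' : J → P → Prop}
    (h : ∀ j p, r' j p ↔ r (e (j, p))) :
    ({k // r k} → Q) ≃ ∀ j, {p // r' j p} → Q where
  toFun a j p := a ⟨e (j, p), (h j p).1 p.2⟩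
  invFun c k := c (e.symm k).1 ⟨(e.symm k).2, (h _ _).2 (by simpa using k.2)⟩
  left_inv a := by simp
  right_inv c := by
    have hc : ∀ x j p, x = (j, p.1) → ∀ hx, c x.1 ⟨x.2, hx⟩ = c j p := by
      rintro _ j p rfl _
      rfl
    exact funext fun j => funext fun p => hc _ j p (e.symm_apply_apply _) _

variable [Fintype J] [Fintype P] [DecidableEq P] [Fintype S] [DecidableEq S]
  [Fintype Q] [DecidableEq Q]

theorem entanglementEntropy_prod (e : J × P ≃ S) {φ : J → (P → Q) → ℂ}
    (hφ : ∀ j, ∑ s, ‖φ j s‖ ^ 2 = 1) (A : Finset S) :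
    entanglementEntropy (fun s => ∏ j, φ j fun p => s (e (j, p))) A =
      ∑ j, entanglementEntropy (φ j) {p | e (j, p) ∈ A} := by
  classical
  set M := fun j => amplitudeMatrix (φ j) {p | e (j, p) ∈ A}
  have hmem : ∀ j p, p ∈ ({p | e (j, p) ∈ A} : Finset P) ↔ e (j, p) ∈ A := fun j p => by simp
  let eIn := blockEquiv (Q := Q) e hmem
  let eOut := blockEquiv (Q := Q) e (r := (· ∉ A))
    (r' := fun j p => p ∉ ({p | e (j, p) ∈ A} : Finset P)) fun j p => (hmem j p).not
  have hM : amplitudeMatrix (fun s => ∏ j, φ j fun p => s (e (j, p))) A =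
      (piKronecker M).submatrix eIn eOut := by
    ext a b
    refine prod_congr rfl fun j _ => congrArg (φ j) (funext fun p => ?_)
    by_cases hp : e (j, p) ∈ A <;> simp [glue, hp, eIn, eOut, blockEquiv]
  have hρ : reducedDensity (fun s => ∏ j, φ j fun p => s (e (j, p))) A =
      reindex eIn.symm eIn.symm (piKronecker fun j => M j * (M j)ᴴ) := by
    rw [reducedDensity_eq_mul_conjTranspose, hM, conjTranspose_submatrix, submatrix_mul_equiv,
      piKronecker_mul, conjTranspose_piKronecker]
    rfl
  refine (vonNeumannEntropy_eq_of_charpoly_eq _ _ (hρ ▸ charpoly_reindex _ _)).trans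
    (vonNeumannEntropy_piKronecker (fun j => reducedDensity_isHermitian (φ j) _) fun j => ?_)
  rw [trace_reducedDensity, hφ, Complex.ofReal_one]

end ProductState

section UniformSuperposition

variable {Ω X : Type*} [Fintype Ω]

open Classical in
/-- The uniform superposition of the basis states `F ω`.  It has norm one when `F` is injective. -/
noncomputable def uniformSuperposition (F : Ω → X) (s : X) : ℂ :=
  if s ∈ Set.range F then ((√(Fintype.card Ω))⁻¹ : ℝ) else 0

theorem sum_norm_sq_uniformSuperposition [Fintype X] {F : Ω → X} (hF : F.Injective)
    (E : X → Prop) [DecidablePred E] :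
    ∑ s with E s, ‖uniformSuperposition F s‖ ^ 2 = (#{ω | E (F ω)} : ℝ) / Fintype.card Ω := by
  classical
  have hnorm : ∀ s, ‖uniformSuperposition F s‖ ^ 2 =
      if s ∈ univ.image F then (Fintype.card Ω : ℝ)⁻¹ else 0 := by
    intro s
    by_cases hs : s ∈ Set.range F
    · rw [uniformSuperposition, if_pos hs, if_pos (by simpa using hs), Complex.norm_real,
        Real.norm_eq_abs, sq_abs, inv_pow, Real.sq_sqrt (Nat.cast_nonneg _)]
    · simp [uniformSuperposition, hs, show ¬∃ ω, F ω = s from hs]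
  calc ∑ s with E s, ‖uniformSuperposition F s‖ ^ 2
      = ∑ s ∈ univ.image F with E s, (Fintype.card Ω : ℝ)⁻¹ := by
        simp only [hnorm, sum_ite_mem, filter_inter, univ_inter]
    _ = (#{ω | E (F ω)} : ℝ) / Fintype.card Ω := by
        rw [sum_const, nsmul_eq_mul, div_eq_mul_inv, filter_image, card_image_of_injective _ hF]

theorem sum_norm_sq_uniformSuperposition_univ [Fintype X] [Nonempty Ω] {F : Ω → X}
    (hF : F.Injective) : ∑ s, ‖uniformSuperposition F s‖ ^ 2 = 1 := by
  simpa using sum_norm_sq_uniformSuperposition hF fun _ => True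

theorem card_filter_forall_mem_eq_mul_two_pow {ι : Type*} [Fintype ι] [DecidableEq ι]
    (G : Finset ι) (z : ι → Bool) :
    #{x : ι → Bool | ∀ q ∈ G, x q = z q} * 2 ^ #G = 2 ^ Fintype.card ι := by
  have h : ({x : ι → Bool | ∀ q ∈ G, x q = z q} : Finset (ι → Bool)) =
      Fintype.piFinset fun q => if q ∈ G then {z q} else univ := by
    ext x
    simp only [mem_filter_univ, Fintype.mem_piFinset]
    exact forall_congr' fun q => by by_cases hq : q ∈ G <;> simp [hq]
  rw [h, Fintype.card_piFinset]
  simp only [apply_ite card, card_singleton, card_univ, Fintype.card_bool, prod_ite, prod_const_one,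
    prod_const, one_mul]
  rw [← pow_add, filter_not, ← compl_eq_univ_sdiff, filter_univ_mem, card_compl_add_card]

variable {T ι : Type*} [Fintype T] [Fintype ι] [DecidableEq ι]

theorem sum_norm_sq_uniformSuperposition_eq_mul_two_rpow [Fintype X] {F : T × (ι → Bool) → X}
    (hF : F.Injective) {E : X → Prop} [DecidablePred E] {late : T → Prop} [DecidablePred late]
    {G : Finset ι} {z : ι → Bool} (hE : ∀ τ x, E (F (τ, x)) ↔ late τ ∧ ∀ q ∈ G, x q = z q) :
    ∑ s with E s, ‖uniformSuperposition F s‖ ^ 2 =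
      (#{τ | late τ} : ℝ) / Fintype.card T * 2 ^ (-(#G : ℝ)) := by
  have hprod : ({ω | E (F ω)} : Finset (T × (ι → Bool))) =
      ({τ | late τ} : Finset T) ×ˢ ({x | ∀ q ∈ G, x q = z q} : Finset (ι → Bool)) := by
    ext ⟨τ, x⟩
    simp only [mem_filter_univ, mem_product, hE]
  have hfibre : (#{x : ι → Bool | ∀ q ∈ G, x q = z q} : ℝ) ≠ 0 :=
    Nat.cast_ne_zero.2 (card_ne_zero.2 ⟨z, by simp⟩)
  rw [sum_norm_sq_uniformSuperposition hF, hprod, card_product, Fintype.card_prod,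
    Fintype.card_fun, Fintype.card_bool, ← card_filter_forall_mem_eq_mul_two_pow G z,
    Real.rpow_neg zero_le_two, Real.rpow_natCast]
  push_cast
  field_simp

variable {S Q : Type*} [Fintype S] [DecidableEq S] [Fintype Q] [DecidableEq Q]

theorem card_mul_le_entanglementEntropy_uniformSuperposition [Nonempty T]
    {F : T × (ι → Bool) → S → Q} (hF : F.Injective) {A : Finset S} {E : (S → Q) → Prop}
    (hE : DependsOn E (A : Set S)ᶜ) {late : T → Prop} [DecidablePred late]
    (hlate : ∀ τ x, E (F (τ, x)) ↔ late τ) {G : Finset ι} {readIn readOut : ι → (S → Q) → Bool}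
    (hin : ∀ q ∈ G, DependsOn (readIn q) A)
    (hout : ∀ q ∈ G, DependsOn (readOut q) (A : Set S)ᶜ)
    (hreadIn : ∀ τ x, late τ → ∀ q ∈ G, readIn q (F (τ, x)) = x q)
    (hreadOut : ∀ τ x, late τ → ∀ q ∈ G, readOut q (F (τ, x)) = x q) :
    (#{τ | late τ} : ℝ) / Fintype.card T * #G ≤
      entanglementEntropy (uniformSuperposition F) A := by
  classical
  refine mul_le_entanglementEntropy_of_dependsOn (sum_norm_sq_uniformSuperposition_univ hF) hE
    (keyIn := fun s (q : G) => readIn q s) (keyOut := fun s (q : G) => readOut q s)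
    (fun s s' h => funext fun q => hin q q.2 h) (fun s s' h => funext fun q => hout q q.2 h)
    ?_ ?_ fun z => ?_
  · intro s hs hEs
    obtain ⟨⟨τ, x⟩, rfl⟩ : s ∈ Set.range F := by
      by_contra h
      exact hs (if_neg h)
    have hτ := (hlate τ x).1 hEs
    exact funext fun q => (hreadIn τ x hτ q q.2).trans (hreadOut τ x hτ q q.2).symm
  · simpa using sum_norm_sq_uniformSuperposition_eq_mul_two_rpow hF (E := E) (late := late)
      (G := ∅) (z := fun _ => false) (by simpa using hlate)
  · refine (sum_norm_sq_uniformSuperposition_eq_mul_two_rpow hF (late := late) (G := G)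
      (z := fun q => if h : q ∈ G then z ⟨q, h⟩ else false) fun τ x => ?_).le
    refine (and_congr_left' (hlate τ x)).trans (and_congr_right fun hτ => ?_)
    rw [funext_iff, Subtype.forall]
    exact forall₂_congr fun q hq => by rw [hreadOut τ x hτ q hq, dif_pos hq]

end UniformSuperposition

section MaximalPath

variable {α : Type*} {R : α → α → Prop}

/-- `s 0, …, s L` is a path of the relation `R` that never branches and ends in a sink. -/
structure IsMaximalPath (R : α → α → Prop) (s : ℕ → α) (L : ℕ) : Prop where
  step_iff : ∀ i < L, ∀ b, R (s i) b ↔ b = s (i + 1)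
  not_step_last : ∀ b, ¬R (s L) b

theorem IsMaximalPath.setOf_reflTransGen {s : ℕ → α} {L : ℕ} (h : IsMaximalPath R s L) :
    {b | Relation.ReflTransGen R (s 0) b} = s '' Set.Iic L := by
  ext b
  constructor
  · intro hb
    induction hb with
    | refl => exact ⟨0, Nat.zero_le L, rfl⟩
    | tail _ hstep ih =>
      obtain ⟨i, hi, rfl⟩ := ih
      obtain rfl | hlt := (Set.mem_Iic.1 hi).eq_or_lt
      · exact absurd hstep (h.not_step_last _)
      · exact ⟨i + 1, hlt, ((h.step_iff i hlt _).1 hstep).symm⟩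
  · rintro ⟨i, hi, rfl⟩
    induction i with
    | zero => exact .refl
    | succ i ih => exact (ih (Nat.le_of_succ_le hi)).tail ((h.step_iff i hi _).2 rfl)

theorem IsMaximalPath.eq_of_eq {s s' : ℕ → α} {L L' i j : ℕ} (h : IsMaximalPath R s L)
    (h' : IsMaximalPath R s' L') (hi : i ≤ L) (hj : j ≤ L') (heq : s i = s' j) :
    L - i = L' - j ∧ s L = s' L' := by
  induction hd : L - i generalizing i j with
  | zero =>
    obtain rfl : i = L := by omega
    obtain rfl | hlt := hj.eq_or_lt
    · exact ⟨by omega, heq⟩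
    · exact absurd (heq ▸ (h'.step_iff j hlt _).2 rfl) (h.not_step_last _)
  | succ d ih =>
    have hstep := (h.step_iff i (by omega) _).2 rfl
    obtain rfl | hlt := hj.eq_or_lt
    · exact absurd (heq ▸ hstep) (h'.not_step_last _)
    · have := ih (by omega) hlt ((h'.step_iff j hlt _).1 (heq ▸ hstep)) (by omega)
      exact ⟨by omega, this.2⟩

end MaximalPath

/-- The control states: the particles that act, one of which is present on the path. -/
def SiteState.isControl : SiteState → Bool
  | .right _ | .dright _ | .left | .turnUp | .dturnUp | .turnDown _ => true
  | _ => false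

/-- The control states that interact with the particle to their right, not to their left. -/
def SiteState.actsRight : SiteState → Bool
  | .right _ | .dright _ | .turnUp | .dturnUp => true
  | _ => false

/-- The left-end turning state that starts round `k`, double in the first round. -/
def SiteState.turner (k : ℕ) : SiteState :=
  if k = 0 then .dturnUp else .turnUp

/-- The right-moving control state of round `k` that carries the qubit value `y`, double in the
first round. -/
def SiteState.mover (k : ℕ) (y : Bool) : SiteState :=
  if k = 0 then .dright y else .right y

namespace TransitionRule

theorem turner_U (k : ℕ) (y : Bool) :
    TransitionRule (.turner k) (.upU y) (.loE y) (.mover k y) := by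
  obtain rfl | hk := eq_or_ne k 0
  · exact dturnUp_U y
  · simpa only [SiteState.turner, SiteState.mover, if_neg hk] using turnUp_U y

theorem mover_U (k : ℕ) (y z : Bool) :
    TransitionRule (.mover k y) (.upU z) (.loU z) (.mover k y) := by
  obtain rfl | hk := eq_or_ne k 0
  · exact dright_U y z
  · simpa only [SiteState.mover, if_neg hk] using right_U y z

theorem mover_W (k : ℕ) (y : Bool) :
    TransitionRule (.mover k y) .upW .loW (.mover k y) := by
  obtain rfl | hk := eq_or_ne k 0
  · exact dright_W y
  · simpa only [SiteState.mover, if_neg hk] using right_W y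

theorem control {a b c d : SiteState} (h : TransitionRule a b c d) :
    (a.isControl ∧ a.actsRight) ∨ (b.isControl ∧ ¬b.actsRight) := by
  cases h <;> simp [SiteState.isControl, SiteState.actsRight]

theorem unique {a b c d c' d' : SiteState} (h : TransitionRule a b c d)
    (h' : TransitionRule a b c' d') : c = c' ∧ d = d' := by
  cases h <;> cases h' <;> exact ⟨rfl, rfl⟩

end TransitionRule

namespace ChainStep

theorem unique {n : ℕ} {s s₁ s₂ : Fin n → SiteState}
    (hs : ∀ p q, (s p).isControl → (s q).isControl → p = q)
    (h₁ : ChainStep n s s₁) (h₂ : ChainStep n s s₂) : s₁ = s₂ := by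
  obtain ⟨k, l, hkl, hr, ho⟩ := h₁
  obtain ⟨k', l', hkl', hr', ho'⟩ := h₂
  have hk : k = k' ∧ l = l' := by
    rcases hr.control with ⟨h, hf⟩ | ⟨h, hf⟩ <;> rcases hr'.control with ⟨h', hf'⟩ | ⟨h', hf'⟩ <;>
      have := hs _ _ h h' <;> subst this
    · exact ⟨rfl, Fin.ext (by omega)⟩
    · exact absurd hf hf'
    · exact absurd hf' hf
    · exact ⟨Fin.ext (by omega), rfl⟩
  obtain ⟨rfl, rfl⟩ := hk
  obtain ⟨hc, hd⟩ := hr.unique hr'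
  ext q
  by_cases hqk : q = k
  · rw [hqk, hc]
  by_cases hql : q = l
  · rw [hql, hd]
  rw [ho q hqk hql, ho' q hqk hql]

theorem of_values {n : ℕ} {s s' : ℕ → SiteState} (c : ℕ) (hc : c + 1 < n)
    {a b a' b' : SiteState} (hr : TransitionRule a b a' b') (ha : s c = a) (hb : s (c + 1) = b)
    (ha' : s' c = a') (hb' : s' (c + 1) = b')
    (hrest : ∀ q < n, q ≠ c → q ≠ c + 1 → s' q = s q) :
    ChainStep n (fun p => s p) (fun p => s' p) := by
  subst ha hb ha' hb'
  exact ⟨⟨c, by omega⟩, ⟨c + 1, hc⟩, rfl, hr, fun q hqc hqc' =>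
    hrest q q.2 (fun h => hqc (Fin.ext h)) fun h => hqc' (Fin.ext h)⟩

end ChainStep

section PathConf

/-- The state of site `p` of a segment of length `2 m + 3` when the control state `ctrl` is at site
`c`, the first `a` qubits are entangled on the left, and the sites from `lim` on hold their
partners.  Sites and qubits are counted from `0`: qubit `q` starts at site `q + 2`, it becomes
entangled between the sites `q + 1` and `2 m + 1 - q`, and `x (p - 2)`, `x (p - 1)`,
`x (2 * m + 1 - p)` are the qubits of site `p` to the right, to the left of the control site and
when entangled on the right. -/
def roundConf (m : ℕ) (x : ℕ → Bool) (a lim c : ℕ) (ctrl : SiteState) (p : ℕ) : SiteState :=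
  if p = 0 then .leftEnd
  else if p = 2 * m + 2 then .rightEnd
  else if p = c then ctrl
  else if p ≤ a then .loE (x (p - 1))
  else if lim ≤ p then .upE (x (2 * m + 1 - p))
  else if p < c then if p ≤ m then .loU (x (p - 1)) else .loW
  else if p ≤ m + 1 then .upU (x (p - 2)) else .upW

/-- The state of site `p` after `k` complete rounds and `r ≤ 4 * (m - k)` further steps.  Round `k`
entangles qubit `k`: a turn at the left end, a sweep to the right, a turn at the right end, and a
sweep back. -/
def pathConf (m : ℕ) (x : ℕ → Bool) (k r p : ℕ) : SiteState :=
  if r = 0 then roundConf m x k (2 * m + 2 - k) (k + 1) (.turner k) p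
  else if r ≤ 2 * (m - k) then
    roundConf m x (k + 1) (2 * m + 2 - k) (k + 1 + r) (.mover k (x k)) p
  else if r = 2 * (m - k) + 1 then
    roundConf m x (k + 1) (2 * m + 2 - k) (2 * m + 1 - k) (.turnDown (x k)) p
  else roundConf m x (k + 1) (2 * m + 1 - k) (4 * m + 2 - 3 * k - r) .left p

theorem eq_of_isControl_roundConf {m : ℕ} {x : ℕ → Bool} {a lim c : ℕ} {ctrl : SiteState} {p : ℕ}
    (h : (roundConf m x a lim c ctrl p).isControl) : p = c := by
  unfold roundConf at h
  grind [SiteState.isControl]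

theorem eq_of_isControl_pathConf {m : ℕ} {x : ℕ → Bool} {k r p p' : ℕ}
    (h : (pathConf m x k r p).isControl) (h' : (pathConf m x k r p').isControl) : p = p' := by
  unfold pathConf at h h'
  split_ifs at h h' <;>
    exact (eq_of_isControl_roundConf h).trans (eq_of_isControl_roundConf h').symm

variable {m k r : ℕ} (x : ℕ → Bool)

theorem chainStep_pathConf_turner (hk : k < m) :
    ChainStep (2 * m + 3) (fun p => pathConf m x k 0 p) (fun p => pathConf m x k 1 p) := by
  refine .of_values (k + 1) (by omega) (.turner_U k (x k)) ?_ ?_ ?_ ?_ ?_ <;>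
    grind (splits := 30) [pathConf, roundConf]

theorem chainStep_pathConf_mover (hk : k < m) (hr : 1 ≤ r) (hr' : r < 2 * (m - k)) :
    ChainStep (2 * m + 3) (fun p => pathConf m x k r p) (fun p => pathConf m x k (r + 1) p) := by
  by_cases hU : k + 1 + r ≤ m
  · refine .of_values (k + 1 + r) (by omega) (.mover_U k (x k) (x (k + r))) ?_ ?_ ?_ ?_ ?_ <;>
      grind (splits := 30) [pathConf, roundConf]
  · refine .of_values (k + 1 + r) (by omega) (.mover_W k (x k)) ?_ ?_ ?_ ?_ ?_ <;>
      grind (splits := 30) [pathConf, roundConf]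

theorem chainStep_pathConf_mover_end (hk : k < m) :
    ChainStep (2 * m + 3) (fun p => pathConf m x k (2 * (m - k)) p)
      (fun p => pathConf m x k (2 * (m - k) + 1) p) := by
  obtain rfl | hk0 := eq_or_ne k 0
  · refine .of_values (2 * m + 1) (by omega) (.dright_end (x 0)) ?_ ?_ ?_ ?_ ?_ <;>
      grind (splits := 30) [pathConf, roundConf, SiteState.mover]
  · refine .of_values (2 * m + 1 - k) (by omega) (.right_E (x k) (x (k - 1))) ?_ ?_ ?_ ?_ ?_ <;>
      grind (splits := 30) [pathConf, roundConf, SiteState.mover]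

theorem chainStep_pathConf_turnDown (hk : k < m) :
    ChainStep (2 * m + 3) (fun p => pathConf m x k (2 * (m - k) + 1) p)
      (fun p => pathConf m x k (2 * (m - k) + 2) p) := by
  refine .of_values (2 * m - k) (by omega) (.w_turnDown (x k)) ?_ ?_ ?_ ?_ ?_ <;>
    grind (splits := 30) [pathConf, roundConf]

theorem chainStep_pathConf_left (hk : k < m) (hr : 2 * (m - k) + 2 ≤ r) (hr' : r < 4 * (m - k)) :
    ChainStep (2 * m + 3) (fun p => pathConf m x k r p) (fun p => pathConf m x k (r + 1) p) := by
  by_cases hU : 4 * m + 1 - 3 * k - r ≤ m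
  · refine .of_values (4 * m + 1 - 3 * k - r) (by omega) (.u_left (x (4 * m - 3 * k - r)))
      ?_ ?_ ?_ ?_ ?_ <;> grind (splits := 30) [pathConf, roundConf]
  · refine .of_values (4 * m + 1 - 3 * k - r) (by omega) .w_left ?_ ?_ ?_ ?_ ?_ <;>
      grind (splits := 30) [pathConf, roundConf]

theorem chainStep_pathConf_left_end (hk : k < m) :
    ChainStep (2 * m + 3) (fun p => pathConf m x k (4 * (m - k)) p)
      (fun p => pathConf m x (k + 1) 0 p) := by
  refine .of_values (k + 1) (by omega) (.e_left (x k)) ?_ ?_ ?_ ?_ ?_ <;>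
    grind (splits := 30) [pathConf, roundConf, SiteState.turner]

theorem chainStep_pathConf (hk : k < m) (hr : r < 4 * (m - k)) :
    ChainStep (2 * m + 3) (fun p => pathConf m x k r p) (fun p => pathConf m x k (r + 1) p) := by
  obtain rfl | hr0 := Nat.eq_zero_or_pos r
  · exact chainStep_pathConf_turner x hk
  obtain h | rfl | h := lt_trichotomy r (2 * (m - k))
  · exact chainStep_pathConf_mover x hk hr0 h
  · exact chainStep_pathConf_mover_end x hk
  obtain rfl | h := (Nat.succ_le_of_lt h).eq_or_lt
  · exact chainStep_pathConf_turnDown x hk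
  · exact chainStep_pathConf_left x hk h hr

theorem not_chainStep_pathConf_last (s : Fin (2 * m + 3) → SiteState) :
    ¬ChainStep (2 * m + 3) (fun p => pathConf m x m 0 p) s := by
  rintro ⟨k, l, hkl, hr, -⟩
  have hctrl : pathConf m x m 0 (m + 1) = .turner m := by grind [pathConf, roundConf]
  have hturner : (SiteState.turner m).isControl ∧ (SiteState.turner m).actsRight := by
    unfold SiteState.turner
    split_ifs <;> exact ⟨rfl, rfl⟩
  have hsite : ∀ p, (pathConf m x m 0 p).isControl → p = m + 1 := fun p hp =>
    eq_of_isControl_pathConf hp (hctrl ▸ hturner.1)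
  rcases hr.control with ⟨h, -⟩ | ⟨h, hleft⟩
  · have hk : (k : ℕ) = m + 1 := hsite k h
    have hl : (l : ℕ) = m + 2 := by omega
    simp only [hk, hl, hctrl] at hr
    obtain rfl | hm := eq_or_ne m 0
    · cases hr
    · have hnext : pathConf m x m 0 (m + 2) = .upE (x (m - 1)) := by
        grind (splits := 30) [pathConf, roundConf]
      simp only [hnext, SiteState.turner, if_neg hm] at hr
      cases hr
  · simp only [hsite l h, hctrl] at hleft
    exact hleft hturner.2

end PathConf

section Trajectory

/-- The number of steps before round `k` of the path on `2 m + 3` sites. -/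
def roundStart (m k : ℕ) : ℕ :=
  ∑ j ∈ range k, (4 * (m - j) + 1)

theorem roundStart_succ (m k : ℕ) : roundStart m (k + 1) = roundStart m k + (4 * (m - k) + 1) :=
  sum_range_succ _ k

theorem strictMono_roundStart (m : ℕ) : StrictMono (roundStart m) :=
  strictMono_nat_of_lt_succ fun k => by rw [roundStart_succ]; omega

theorem roundStart_add_two_mul_sq {m k : ℕ} (hk : k ≤ m) :
    roundStart m k + 2 * k ^ 2 = k * (4 * m + 3) := by
  induction k with
  | zero => simp [roundStart]
  | succ k ih =>
    obtain ⟨d, rfl⟩ := Nat.exists_eq_add_of_lt hk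
    have := ih (by omega)
    rw [roundStart_succ, show k + d + 1 - k = d + 1 by omega]
    linarith

/-- The round at time `τ` and the number of steps made in it. -/
def clock (m : ℕ) : ℕ → ℕ × ℕ
  | 0 => (0, 0)
  | τ + 1 =>
    if (clock m τ).2 < 4 * (m - (clock m τ).1) then ((clock m τ).1, (clock m τ).2 + 1)
    else ((clock m τ).1 + 1, 0)

theorem clock_spec (m τ : ℕ) : roundStart m (clock m τ).1 + (clock m τ).2 = τ ∧
    (clock m τ).2 ≤ 4 * (m - (clock m τ).1) := by
  induction τ with
  | zero => simp [clock, roundStart]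
  | succ τ ih =>
    rw [clock]
    split_ifs with h
    · exact ⟨by dsimp only; omega, h⟩
    · exact ⟨by simp only [roundStart_succ]; omega, Nat.zero_le _⟩

theorem clock_fst_lt {m τ : ℕ} (hτ : τ < roundStart m m) : (clock m τ).1 < m := by
  have := (clock_spec m τ).1
  exact (strictMono_roundStart m).lt_iff_lt.1 (by omega)

theorem clock_fst_le {m τ : ℕ} (hτ : τ ≤ roundStart m m) : (clock m τ).1 ≤ m := by
  have := (clock_spec m τ).1
  exact (strictMono_roundStart m).le_iff_le.1 (by omega)

theorem clock_roundStart (m : ℕ) : clock m (roundStart m m) = (m, 0) := by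
  have hk := clock_fst_le (le_refl (roundStart m m))
  obtain ⟨hτ, hr⟩ := clock_spec m (roundStart m m)
  obtain hlt | heq := hk.lt_or_eq
  · have := (strictMono_roundStart m).monotone (Nat.succ_le_of_lt hlt)
    rw [roundStart_succ] at this
    omega
  · rw [heq] at hr
    exact Prod.ext heq (by omega)

/-- The qubit values of a segment of length `2 m + 3`. The index type is left in the form in which
it occurs in `startState (2 * m + 3)`. -/
abbrev Qubits (m : ℕ) : Type := Fin ((2 * m + 3 - 3) / 2) → Bool

/-- The qubit values, extended by `false`. -/
def Qubits.bit {m : ℕ} (x : Qubits m) (q : ℕ) : Bool :=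
  if h : q < (2 * m + 3 - 3) / 2 then x ⟨q, h⟩ else false

theorem Qubits.bit_val {m : ℕ} (x : Qubits m) (q : Fin ((2 * m + 3 - 3) / 2)) : x.bit q = x q :=
  dif_pos q.2

/-- The basis state at time `τ` of the path that begins with the qubit values `x`. -/
def trajectory (m : ℕ) (x : Qubits m) (τ : ℕ) : Fin (2 * m + 3) → SiteState :=
  fun p => pathConf m x.bit (clock m τ).1 (clock m τ).2 p

variable {m : ℕ}

theorem trajectory_zero (x : Qubits m) : trajectory m x 0 = startState (2 * m + 3) x := by
  ext p
  have := p.2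
  simp only [trajectory, clock, startState, pathConf, roundConf, Qubits.bit, SiteState.turner]
  grind

theorem chainStep_trajectory (x : Qubits m) {τ : ℕ} (hτ : τ < roundStart m m) :
    ChainStep (2 * m + 3) (trajectory m x τ) (trajectory m x (τ + 1)) := by
  have hk := clock_fst_lt hτ
  have hr := (clock_spec m τ).2
  unfold trajectory
  rw [clock]
  split_ifs with h
  · exact chainStep_pathConf x.bit hk h
  · rw [le_antisymm hr (not_lt.1 h)]
    exact chainStep_pathConf_left_end x.bit hk

theorem isMaximalPath_trajectory (x : Qubits m) :
    IsMaximalPath (ChainStep (2 * m + 3)) (trajectory m x) (roundStart m m) where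
  step_iff τ hτ s := by
    refine ⟨fun hs => ?_, fun hs => hs ▸ chainStep_trajectory x hτ⟩
    exact hs.unique (fun p q hp hq => Fin.ext (eq_of_isControl_pathConf hp hq))
      (chainStep_trajectory x hτ)
  not_step_last s := by
    unfold trajectory
    rw [clock_roundStart]
    exact not_chainStep_pathConf_last x.bit s

theorem startPath_eq_image (x : Qubits m) :
    startPath (2 * m + 3) x = trajectory m x '' Set.Iic (roundStart m m) := by
  rw [← (isMaximalPath_trajectory x).setOf_reflTransGen, trajectory_zero]
  rfl

theorem eq_of_trajectory_last_eq {x x' : Qubits m}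
    (h : trajectory m x (roundStart m m) = trajectory m x' (roundStart m m)) : x = x' := by
  have hlast : ∀ y : Qubits m, ∀ q : Fin ((2 * m + 3 - 3) / 2),
      trajectory m y (roundStart m m) ⟨q + 1, by omega⟩ = .loE (y q) := by
    intro y q
    rw [trajectory, clock_roundStart, ← y.bit_val]
    grind (splits := 30) [pathConf, roundConf]
  ext q
  simpa only [hlast, SiteState.loE.injEq] using congrFun h ⟨q + 1, by omega⟩

/-- The basis states that occur in the ground state, by time and qubit values. -/
def segConf (m : ℕ) (ω : Fin (roundStart m m + 1) × Qubits m) : Fin (2 * m + 3) → SiteState :=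
  trajectory m ω.2 ω.1

theorem segConf_injective : (segConf m).Injective := by
  rintro ⟨τ, x⟩ ⟨τ', x'⟩ h
  obtain ⟨hsub, hlast⟩ := (isMaximalPath_trajectory x).eq_of_eq (isMaximalPath_trajectory x')
    (Nat.le_of_lt_succ τ.2) (Nat.le_of_lt_succ τ'.2) h
  exact Prod.ext (Fin.ext (by dsimp only; omega)) (eq_of_trajectory_last_eq hlast)

theorem startPath_eq_range (x : Qubits m) :
    startPath (2 * m + 3) x = Set.range fun τ => segConf m (τ, x) := by
  rw [startPath_eq_image]
  ext s
  simp only [Set.mem_image, Set.mem_Iic, Set.mem_range, Fin.exists_iff, segConf, Nat.lt_succ_iff,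
    exists_prop]

theorem ncard_startPath (x : Qubits m) : (startPath (2 * m + 3) x).ncard = roundStart m m + 1 := by
  have hinj : Function.Injective fun τ => segConf m (τ, x) := fun τ τ' h =>
    congrArg Prod.fst (segConf_injective h)
  rw [startPath_eq_range, ← Set.image_univ, Set.ncard_image_of_injective _ hinj, Set.ncard_univ,
    Nat.card_eq_fintype_card, Fintype.card_fin]

theorem segConf_mem_startPath {ω : Fin (roundStart m m + 1) × Qubits m} {x : Qubits m} :
    segConf m ω ∈ startPath (2 * m + 3) x ↔ x = ω.2 := by
  rw [startPath_eq_range]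
  refine ⟨?_, fun h => ⟨ω.1, by rw [h]⟩⟩
  rintro ⟨τ, h⟩
  exact congrArg Prod.snd (segConf_injective h)

theorem phiGround_eq_uniformSuperposition :
    phiGround (2 * m + 3) = uniformSuperposition (segConf m) := by
  ext s
  by_cases hs : s ∈ Set.range (segConf m)
  · rw [uniformSuperposition, if_pos hs]
    obtain ⟨ω, rfl⟩ := hs
    simp only [phiGround, phiPath, segConf_mem_startPath, ncard_startPath, sum_ite_eq', mem_univ,
      if_true]
    rw [← Complex.ofReal_mul, ← mul_inv, ← Real.sqrt_mul (by positivity), mul_comm]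
    simp
  · have hs' : ∀ x : Qubits m, s ∉ startPath (2 * m + 3) x := by
      intro x hx
      rw [startPath_eq_range] at hx
      obtain ⟨τ, rfl⟩ := hx
      exact hs ⟨_, rfl⟩
    simp only [phiGround, phiPath, hs', uniformSuperposition, if_neg hs, if_false, sum_const_zero,
      mul_zero]

end Trajectory

section Segment

variable {m : ℕ}

/-- The site at the left end where qubit `q`, counted from `0`, becomes entangled. -/
def leftSite (m : ℕ) (q : Fin ((2 * m + 3 - 3) / 2)) : Fin (2 * m + 3) :=
  ⟨q + 1, by omega⟩

/-- The partner of `leftSite m q` at the right end. -/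
def rightSite (m : ℕ) (q : Fin ((2 * m + 3 - 3) / 2)) : Fin (2 * m + 3) :=
  ⟨2 * m + 1 - q, by omega⟩

/-- At time `τ` the turn at the right end of round `q` is over, so that qubit `q` is present at both
ends. -/
def EntangledAt (m q τ : ℕ) : Prop :=
  q < (clock m τ).1 ∨ q = (clock m τ).1 ∧ 2 * (m - (clock m τ).1) + 2 ≤ (clock m τ).2

/-- The states `E`, the entangled qubits at the right end. -/
def SiteState.isUpE : SiteState → Bool
  | .upE _ => true
  | _ => false

/-- The value of an entangled qubit; it is set to `false` for all other states. -/
def SiteState.entangledBit : SiteState → Bool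
  | .upE y | .loE y => y
  | _ => false

theorem EntangledAt.mono {q K τ : ℕ} (h : EntangledAt m K τ) (hq : q ≤ K) : EntangledAt m q τ := by
  unfold EntangledAt at *
  omega

theorem isUpE_trajectory_rightSite (x : Qubits m) (q : Fin ((2 * m + 3 - 3) / 2)) {τ : ℕ}
    (hτ : τ ≤ roundStart m m) :
    (trajectory m x τ (rightSite m q)).isUpE ↔ EntangledAt m q τ := by
  have hq : (q : ℕ) < m := by omega
  have hk := clock_fst_le hτ
  have hr := (clock_spec m τ).2
  unfold EntangledAt trajectory pathConf roundConf rightSite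
  grind (splits := 40) [SiteState.isUpE, SiteState.mover, SiteState.turner]

theorem trajectory_rightSite (x : Qubits m) (q : Fin ((2 * m + 3 - 3) / 2)) {τ : ℕ}
    (hτ : τ ≤ roundStart m m) (h : EntangledAt m q τ) :
    trajectory m x τ (rightSite m q) = .upE (x q) := by
  have hq : (q : ℕ) < m := by omega
  have hsub : 2 * m + 1 - (2 * m + 1 - q) = (q : ℕ) := by omega
  have hk := clock_fst_le hτ
  have hr := (clock_spec m τ).2
  rw [← x.bit_val]
  unfold EntangledAt at h
  unfold trajectory pathConf roundConf rightSite
  grind (splits := 40)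

theorem trajectory_leftSite (x : Qubits m) (q : Fin ((2 * m + 3 - 3) / 2)) {τ : ℕ}
    (hτ : τ ≤ roundStart m m) (h : EntangledAt m q τ) :
    trajectory m x τ (leftSite m q) = .loE (x q) := by
  have hk := clock_fst_le hτ
  have hr := (clock_spec m τ).2
  rw [← x.bit_val]
  unfold EntangledAt at h
  unfold trajectory pathConf roundConf leftSite
  grind (splits := 40)

theorem entangledAt_of_le {q τ : ℕ} (hτ : roundStart m q + 2 * (m - q) + 2 ≤ τ) :
    EntangledAt m q τ := by
  obtain ⟨hsum, hr⟩ := clock_spec m τ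
  have hk : q ≤ (clock m τ).1 := by
    by_contra! hlt
    have := (strictMono_roundStart m).monotone (Nat.succ_le_of_lt hlt)
    rw [roundStart_succ] at this
    omega
  obtain heq | hlt := hk.eq_or_lt
  · exact .inr ⟨heq, by rw [← heq] at hsum ⊢; omega⟩
  · exact .inl hlt

open Classical in
theorem one_div_four_le_card_entangledAt {q : ℕ} (hq : 2 * q < m) :
    (1 / 4 : ℝ) ≤ (#{τ : Fin (roundStart m m + 1) | EntangledAt m q τ} : ℝ) /
      Fintype.card (Fin (roundStart m m + 1)) := by
  set τ₀ := roundStart m q + 2 * (m - q) + 2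
  have hquarter : roundStart m m + 1 + 4 * τ₀ ≤ 4 * (roundStart m m + 1) := by
    have hm := roundStart_add_two_mul_sq (le_refl m)
    have hq' := roundStart_add_two_mul_sq (m := m) (k := q) (by omega)
    have hsub : τ₀ + 2 * q = roundStart m q + 2 * m + 2 := by omega
    nlinarith
  have hcard : roundStart m m + 1 - τ₀ ≤
      #{τ : Fin (roundStart m m + 1) | EntangledAt m q τ} := by
    rw [← Fin.card_Ici (⟨τ₀, by omega⟩ : Fin (roundStart m m + 1))]
    exact card_le_card fun τ hτ => by
      simpa using entangledAt_of_le (Fin.le_def.1 (mem_Ici.1 hτ))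
  rw [Fintype.card_fin, div_le_div_iff₀ (by norm_num) (by positivity)]
  norm_cast
  omega

variable {A : Finset (Fin (2 * m + 3))} {G : Finset (Fin ((2 * m + 3 - 3) / 2))}

theorem card_div_four_le_entanglementEntropy_phiGround_of_notMem
    (hG : ∀ q ∈ G, leftSite m q ∈ A ↔ rightSite m q ∉ A) {K : Fin ((2 * m + 3 - 3) / 2)}
    (hGK : ∀ q ∈ G, q ≤ K) (hK : 2 * (K : ℕ) < m) (hKA : rightSite m K ∉ A) :
    (#G : ℝ) / 4 ≤ entanglementEntropy (phiGround (2 * m + 3)) A := by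
  classical
  let siteIn q := if leftSite m q ∈ A then leftSite m q else rightSite m q
  let siteOut q := if leftSite m q ∈ A then rightSite m q else leftSite m q
  have hIn : ∀ q ∈ G, siteIn q ∈ A := by grind
  have hOut : ∀ q ∈ G, siteOut q ∉ A := by grind
  have hread : ∀ (τ : Fin (roundStart m m + 1)) x, EntangledAt m K τ → ∀ q ∈ G, ∀ p,
      p = leftSite m q ∨ p = rightSite m q → (segConf m (τ, x) p).entangledBit = x q := by
    rintro τ x hτK q hq p hp
    have hτ := Nat.le_of_lt_succ τ.2
    have hτq := hτK.mono (hGK q hq)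
    obtain rfl | rfl := hp
    · exact congrArg _ (trajectory_leftSite x q hτ hτq)
    · exact congrArg _ (trajectory_rightSite x q hτ hτq)
  have key := card_mul_le_entanglementEntropy_uniformSuperposition segConf_injective
    (A := A) (G := G) (E := fun s => (s (rightSite m K)).isUpE)
    (late := fun τ => EntangledAt m K τ) (readIn := fun q s => (s (siteIn q)).entangledBit)
    (readOut := fun q s => (s (siteOut q)).entangledBit)
    (fun s s' h => by simp only [h _ hKA])
    (fun τ x => isUpE_trajectory_rightSite x K (Nat.le_of_lt_succ τ.2))
    (fun q hq s s' h => congrArg SiteState.entangledBit (h _ (hIn q hq)))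
    (fun q hq s s' h => congrArg SiteState.entangledBit (h _ (hOut q hq)))
    (fun τ x hτ q hq => hread τ x hτ q hq _ (by grind))
    (fun τ x hτ q hq => hread τ x hτ q hq _ (by grind))
  rw [phiGround_eq_uniformSuperposition]
  refine le_trans ?_ key
  rw [div_eq_inv_mul, ← one_div]
  exact mul_le_mul_of_nonneg_right (one_div_four_le_card_entangledAt hK) (Nat.cast_nonneg _)

theorem card_div_four_le_entanglementEntropy_phiGround
    (hG : ∀ q ∈ G, leftSite m q ∈ A ↔ rightSite m q ∉ A) (hGm : ∀ q ∈ G, 2 * (q : ℕ) < m) :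
    (#G : ℝ) / 4 ≤ entanglementEntropy (phiGround (2 * m + 3)) A := by
  obtain rfl | hne := G.eq_empty_or_nonempty
  · rw [phiGround_eq_uniformSuperposition]
    simpa using card_mul_le_entanglementEntropy_uniformSuperposition segConf_injective (A := A)
      (E := fun _ => False) (fun _ _ _ => rfl) (late := fun _ => False) (fun _ _ => Iff.rfl)
      (G := ∅) (readIn := fun _ _ => false) (readOut := fun _ _ => false)
      (by simp) (by simp) (by simp) (by simp)
  have hKm := hGm _ (G.max'_mem hne)
  by_cases hKA : rightSite m (G.max' hne) ∈ A
  · rw [← entanglementEntropy_compl]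
    refine card_div_four_le_entanglementEntropy_phiGround_of_notMem (fun q hq => ?_)
      (fun q hq => G.le_max' q hq) hKm (by simpa using hKA)
    simp only [mem_compl, hG q hq]
  · exact card_div_four_le_entanglementEntropy_phiGround_of_notMem hG
      (fun q hq => G.le_max' q hq) hKm hKA

end Segment

section Cycle

variable {n t : ℕ} [NeZero (n * t)]

theorem segmentSite_bijective (i : Fin n) :
    Function.Bijective fun jp : Fin t × Fin n => segmentSite n t i jp.1 (jp.2 + 1) := by
  rw [Fintype.bijective_iff_injective_and_card]
  refine ⟨?_, by simp only [Fintype.card_prod, Fintype.card_fin, mul_comm]⟩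
  rintro ⟨j, p⟩ ⟨j', p'⟩ h
  have hoffset : ∀ jp : Fin t × Fin n,
      (jp.1 : ℕ) * n + jp.2 = finCongr (mul_comm t n) (finProdFinEquiv jp) := fun jp => by
    simp [add_comm, mul_comm]
  have hmod : (i : ℕ) + j * n + p ≡ i + j' * n + p' [MOD n * t] := congrArg Fin.val h
  rw [add_assoc, add_assoc, hoffset (j, p), hoffset (j', p')] at hmod
  have heq := (Nat.ModEq.add_left_cancel' _ hmod).eq_of_lt_of_lt (Fin.is_lt _) (Fin.is_lt _)
  exact finProdFinEquiv.injective ((finCongr _).injective (Fin.ext heq))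

/-- The sites of the cycle as pairs of a segment and a position in it. Positions are counted from
`0` here, whereas `segmentSite` counts them from `1`. -/
noncomputable def segmentEquiv (i : Fin n) : Fin t × Fin n ≃ Fin (n * t) :=
  .ofBijective _ (segmentSite_bijective i)

end Cycle

section GoodPairs

variable {m t : ℕ}

open Classical in
/-- The qubits of a segment that make a particle in `A` good: of the two sites of the qubit exactly
one lies in `A`. The bound on `q` is `3n/4 ≤ p` for `n = 2m + 3` and `p = 2m + 2 - q`, the position
of its right site; for the left site, `p = q + 2 ≤ n/4` implies it. -/
noncomputable def goodQubits (A : Finset (Fin (2 * m + 3))) :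
    Finset (Fin ((2 * m + 3 - 3) / 2)) :=
  {q | 2 * (q : ℕ) < m ∧ (leftSite m q ∈ A ↔ rightSite m q ∉ A)}

theorem mem_goodQubits {A : Finset (Fin (2 * m + 3))} {q : Fin ((2 * m + 3 - 3) / 2)} :
    q ∈ goodQubits A ↔ 2 * (q : ℕ) < m ∧ (leftSite m q ∈ A ↔ rightSite m q ∉ A) :=
  mem_filter_univ q

variable [NeZero ((2 * m + 3) * t)]

theorem card_goodParticles_le_sum_card_goodQubits (i : Fin (2 * m + 3))
    (A : Finset (Fin ((2 * m + 3) * t))) :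
    #(goodParticles (2 * m + 3) t i A) ≤
      ∑ j : Fin t, #(goodQubits {p | segmentEquiv i (j, p) ∈ A}) := by
  classical
  rw [← card_sigma]
  refine card_le_card_of_surjOn (fun jq => segmentEquiv i (jq.1,
    if segmentEquiv i (jq.1, leftSite m jq.2) ∈ A then leftSite m jq.2 else rightSite m jq.2)) ?_
  intro k hk
  obtain ⟨hkA, j, p, hj, rfl, hp, hpA⟩ := mem_filter.1 hk
  have hsite : ∀ p' : Fin (2 * m + 3), segmentSite (2 * m + 3) t i j (p' + 1) =
      segmentEquiv i (⟨j, hj⟩, p') := fun _ => rfl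
  have hp' : 2 ≤ p ∧ 4 * p ≤ 2 * m + 3 ∨ 3 * (2 * m + 3) ≤ 4 * p ∧ p + 1 ≤ 2 * m + 3 := by
    rify at hp ⊢
    refine hp.imp (And.imp_right fun h => ?_) (And.imp_left fun h => ?_) <;> linarith
  obtain ⟨hp2, hpm⟩ | ⟨hpm, hpn⟩ := hp'
  · let q : Fin ((2 * m + 3 - 3) / 2) := ⟨p - 2, by omega⟩
    have hleft : p = leftSite m q + 1 := by simp only [leftSite, q]; omega
    have hright : 2 * m + 3 + 1 - p = rightSite m q + 1 := by simp only [rightSite, q]; omega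
    rw [hright, hsite] at hpA
    rw [hleft, hsite] at hkA ⊢
    have hq : q ∈ goodQubits {p | segmentEquiv i (⟨j, hj⟩, p) ∈ A} :=
      mem_goodQubits.2 ⟨by simp only [q]; omega, by simp [hkA, hpA]⟩
    exact ⟨⟨⟨j, hj⟩, q⟩, mem_coe.2 (mem_sigma.2 ⟨mem_univ _, hq⟩), by simp [hkA]⟩
  · let q : Fin ((2 * m + 3 - 3) / 2) := ⟨2 * m + 2 - p, by omega⟩
    have hleft : 2 * m + 3 + 1 - p = leftSite m q + 1 := by simp only [leftSite, q]; omega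
    have hright : p = rightSite m q + 1 := by simp only [rightSite, q]; omega
    rw [hleft, hsite] at hpA
    rw [hright, hsite] at hkA ⊢
    have hq : q ∈ goodQubits {p | segmentEquiv i (⟨j, hj⟩, p) ∈ A} :=
      mem_goodQubits.2 ⟨by simp only [q]; omega, by simp [hkA, hpA]⟩
    exact ⟨⟨⟨j, hj⟩, q⟩, mem_coe.2 (mem_sigma.2 ⟨mem_univ _, hq⟩), by simp [hpA]⟩

theorem entanglementEntropy_psiCycle (i : Fin (2 * m + 3)) (A : Finset (Fin ((2 * m + 3) * t))) :
    entanglementEntropy (psiCycle (2 * m + 3) t i) A =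
      ∑ j : Fin t, entanglementEntropy (phiGround (2 * m + 3)) {p | segmentEquiv i (j, p) ∈ A} := by
  refine entanglementEntropy_prod (segmentEquiv i) (φ := fun _ => phiGround (2 * m + 3))
    (fun _ => ?_) A
  rw [phiGround_eq_uniformSuperposition]
  exact sum_norm_sq_uniformSuperposition_univ segConf_injective

end GoodPairs

theorem mainTheorem8_general (n t : ℕ) [NeZero (n * t)] (hn : Odd n) (hn3 : 3 ≤ n)
    (i : Fin n) (A : Finset (Fin (n * t))) :
    ((goodParticles n t i A).card : ℝ) / 4 ≤ entanglementEntropy (psiCycle n t i) A := by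
  obtain ⟨m, rfl⟩ : ∃ m, n = 2 * m + 3 := by
    obtain ⟨l, rfl⟩ := hn
    exact ⟨l - 1, by omega⟩
  calc (#(goodParticles (2 * m + 3) t i A) : ℝ) / 4
    _ ≤ (∑ j : Fin t, #(goodQubits {p | segmentEquiv i (j, p) ∈ A}) : ℕ) / 4 := by
      gcongr
      exact card_goodParticles_le_sum_card_goodQubits i A
    _ = ∑ j : Fin t, (#(goodQubits {p | segmentEquiv i (j, p) ∈ A}) : ℝ) / 4 := by
      rw [Nat.cast_sum, sum_div]
    _ ≤ ∑ j : Fin t,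
        entanglementEntropy (phiGround (2 * m + 3)) {p | segmentEquiv i (j, p) ∈ A} :=
      sum_le_sum fun j _ => card_div_four_le_entanglementEntropy_phiGround
        (fun q hq => (mem_goodQubits.1 hq).2) (fun q hq => (mem_goodQubits.1 hq).1)
    _ = entanglementEntropy (psiCycle (2 * m + 3) t i) A :=
      (entanglementEntropy_psiCycle i A).symm

theorem mainTheorem8 (n t : ℕ) [NeZero (n * t)] (hn : Odd n) (hn3 : 3 ≤ n) (ht : 2 ≤ t)
    (i : Fin n) (a : Fin (n * t)) (r : ℕ) (hr : r + n ≤ n * t) :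
    ((goodParticles n t i (arc a r)).card : ℝ) / 4 ≤
      entanglementEntropy (psiCycle n t i) (arc a r) :=
  mainTheorem8_general n t hn hn3 i _
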